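/- Consider online vertex-weighted bipartite matching. The input is a finite bipartite graph $G=(U,V,E)$ with weights $b_u\ge 0$ for $u\in U$, together with an arrival order $\pi$ of $V$. The set $U$ and the weights are known in advance. The vertices of $V$ arrive one at a time in the order $\pi$. When $v\in V$ arrives, its incident edges are revealed, and the algorithm must irrevocably either match $v$ to a neighbor in $U$ that is still unmatched or leave $v$ unmatched forever. Let $\mathrm{ALG}(G,\pi)$ be the expected total weight of the vertices of $U$ matched at the end, and let $\mathrm{OPT}(G)$ be the maximum, over all matchings of $G$, of the total weight of the matched vertices of $U$. The competitive ratio of a (randomized) online algorithm is $\inf_{(G,\pi)} \mathrm{ALG}(G,\pi)/\mathrm{OPT}(G)$ over all inputs with $\mathrm{OPT}(G)>0$. The algorithm Perturbed-Greedy draws numbers $x_u$, $u\in U$, independently and uniformly from $[0,1]$. It matches each arriving vertex $v$ that has an unmatched neighbor to the unmatched neighbor $u$ that maximizes $b_u\,\psi(x_u)$, where $\psi(x)=1-e^{-(1-x)}$. Ties are broken by vertex id. Theorem. The competitive ratio of Perturbed-Greedy is $1-1/e$, and no randomized online algorithm has a competitive ratio greater than $1-1/e$. -/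

import Mathlib

open MeasureTheory

universe u

noncomputable section

namespace OnlineMatching

/-- An input `(G, π)` of online vertex-weighted bipartite matching. The offline side is
`U = Fin m` with nonnegative weights `b`, the online side is `V = Fin n`, the edges are `E ⊆ U × V`,
and `π t` is the vertex of `V` that arrives at time `t`. -/
structure Input where
  m : ℕ
  n : ℕ
  b : Fin m → ℝ
  b_nonneg : ∀ u, 0 ≤ b u
  E : Finset (Fin m × Fin n)
  π : Equiv.Perm (Fin n)

/-- A set of pairs in `U × V` is a matching if no two different pairs in it share an endpoint. -/
def IsMatching {m n : ℕ} (M : Finset (Fin m × Fin n)) : Prop :=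
  ∀ e ∈ M, ∀ f ∈ M, e.1 = f.1 ∨ e.2 = f.2 → e = f

open Classical in
/-- The finite set of all matchings of the graph with edge set `E`. -/
def matchings {m n : ℕ} (E : Finset (Fin m × Fin n)) : Finset (Finset (Fin m × Fin n)) :=
  E.powerset.filter IsMatching

theorem matchings_nonempty {m n : ℕ} (E : Finset (Fin m × Fin n)) : (matchings E).Nonempty :=
  ⟨∅, by simp [matchings, IsMatching]⟩

/-- `OPT(G)`: the largest total weight of the vertices of `U` matched by a matching of `G`. -/
def Input.opt (I : Input) : ℝ :=
  (matchings I.E).sup' (matchings_nonempty I.E) (fun M => ∑ e ∈ M, I.b e.1)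

/-- The neighbors in `U` of a vertex `v` of `V`. -/
def Input.nbrs (I : Input) (v : Fin I.n) : Finset (Fin I.m) :=
  Finset.univ.filter (fun u => (u, v) ∈ I.E)

/-- What is revealed when an online vertex arrives: its name and the set of its neighbors. -/
abbrev Arrival (m : ℕ) : Type := ℕ × Finset (Fin m)

/-- The sequence of revealed arrivals, in the order of arrival. -/
def Input.arrivals (I : Input) : List (Arrival I.m) :=
  List.ofFn (fun t : Fin I.n => ((I.π t : ℕ), I.nbrs (I.π t)))

/-- A deterministic online strategy on the offline side `Fin m`. From the arrivals that came before,
the set of offline vertices that are already matched and the current arrival, it names the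
offline vertex to which the current arrival is to be matched, or none. -/
abbrev Strategy (m : ℕ) : Type :=
  List (Arrival m) → Finset (Fin m) → Arrival m → Option (Fin m)

/-- One step of a strategy. The state consists of the past arrivals and the set of matched
offline vertices. The named vertex gets matched if it is an unmatched neighbor of the arrival;
otherwise the arrival stays unmatched forever. -/
def step {m : ℕ} (s : Strategy m) (state : List (Arrival m) × Finset (Fin m)) (a : Arrival m) :
    List (Arrival m) × Finset (Fin m) :=
  (state.1 ++ [a],
    match s state.1 state.2 a with
    | none => state.2
    | some u => if u ∈ a.2 ∧ u ∉ state.2 then insert u state.2 else state.2)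

/-- The set of offline vertices that are matched at the end. -/
def matched {m : ℕ} (s : Strategy m) (l : List (Arrival m)) : Finset (Fin m) :=
  (l.foldl (step s) ([], ∅)).2

/-- A randomized online strategy on the offline side `Fin m`: a random choice of a
deterministic one. -/
structure RandomizedStrategy (m : ℕ) where
  Ω : Type u
  [measurableSpace : MeasurableSpace Ω]
  μ : Measure Ω
  [isProbabilityMeasure : IsProbabilityMeasure μ]
  strategy : Ω → Strategy m
  measurable_strategy : ∀ (past : List (Arrival m)) (S : Finset (Fin m)) (a : Arrival m)
    (u : Fin m), MeasurableSet {ω | strategy ω past S a = some u}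

/-- A randomized online algorithm knows the offline vertices and their weights in advance,
and nothing else. -/
abbrev RandomizedAlgorithm : Type (u + 1) :=
  (m : ℕ) → (Fin m → ℝ) → RandomizedStrategy.{u} m

/-- The expected gain `ALG(G, π)`: the expected total weight of the matched offline vertices. -/
def expectedGain (A : RandomizedAlgorithm.{u}) (I : Input) : ℝ :=
  letI := (A I.m I.b).measurableSpace
  ∫ ω, ∑ u ∈ matched ((A I.m I.b).strategy ω) I.arrivals, I.b u ∂(A I.m I.b).μ

/-- The competitive ratio: the infimum of `ALG(G, π) / OPT(G)` over all inputs with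
`OPT(G) > 0`. -/
def competitiveRatio (A : RandomizedAlgorithm.{u}) : EReal :=
  ⨅ (I : Input) (_ : 0 < I.opt), ((expectedGain A I / I.opt : ℝ) : EReal)

/-- The perturbation function. -/
def ψ (x : ℝ) : ℝ := 1 - Real.exp (-(1 - x))

/-- The elements of `C` at which the perturbed weight `b u * ψ (x u)` is the highest. -/
def maximizers {m : ℕ} (b : Fin m → ℝ) (x : Fin m → unitInterval) (C : Finset (Fin m)) :
    Finset (Fin m) :=
  C.filter (fun u => ∀ w ∈ C, b w * ψ (x w) ≤ b u * ψ (x u))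

/-- Given the numbers `x`, match the arrival to the unmatched neighbor with the highest perturbed
weight, if there is an unmatched neighbor; ties are broken in favor of the smallest vertex id. -/
def perturbedGreedyStrategy {m : ℕ} (b : Fin m → ℝ) (x : Fin m → unitInterval) : Strategy m :=
  fun _ S a =>
    if h : (maximizers b x (a.2 \ S)).Nonempty then
      some ((maximizers b x (a.2 \ S)).min' h)
    else none

theorem measurableSet_maximizers {m : ℕ} (b : Fin m → ℝ) (C D : Finset (Fin m)) :
    MeasurableSet {x : Fin m → unitInterval | maximizers b x C = D} := by
  have hmeas : ∀ u : Fin m, Measurable (fun x : Fin m → unitInterval => b u * ψ (x u)) := by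
    intro u
    unfold ψ
    fun_prop
  have h : ∀ u : Fin m, MeasurableSet {x : Fin m → unitInterval | u ∈ maximizers b x C} := by
    intro u
    simp only [maximizers, Finset.mem_filter, measurableSet_setOfPred]
    refine Measurable.and measurable_const (Measurable.forall fun w => ?_)
    exact Measurable.imp measurable_const (measurableSet_setOfPred.1 (measurableSet_le (hmeas w) (hmeas u)))
  simp only [Finset.ext_iff]
  rw [measurableSet_setOfPred]
  exact Measurable.forall fun u => Measurable.iff (measurableSet_setOfPred.1 (h u)) measurable_const

/-- Perturbed-Greedy: the numbers `x u` are independent and uniform in `[0, 1]`. -/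
def perturbedGreedy : RandomizedAlgorithm.{0} := fun m b =>
  { Ω := Fin m → unitInterval
    μ := Measure.pi (fun _ => volume)
    strategy := perturbedGreedyStrategy b
    measurable_strategy := by
      intro past S a u
      have h : {x : Fin m → unitInterval | perturbedGreedyStrategy b x past S a = some u} =
          ⋃ D ∈ {D : Finset (Fin m) | ∃ h : D.Nonempty, D.min' h = u},
            {x | maximizers b x (a.2 \ S) = D} := by
        ext x
        simp [perturbedGreedyStrategy]
      rw [h]
      exact MeasurableSet.biUnion (Set.to_countable _) fun D _ =>
        measurableSet_maximizers b _ D }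

end OnlineMatching

end

noncomputable section

namespace OnlineMatching

/-! Lower bound: a randomized primal-dual argument. When an arrival takes `p`, split the gain `b p`
into a share `b p * (1 - ψ (x p))` for `p` and a share `b p * ψ (x p)` for the arrival. It is enough
that for every edge `(u, v)` the expected shares of its two ends add up to at least `(1 - 1/e) * b
u`; summing this over an optimal matching gives the ratio. Fix all numbers except `y = x u`, and let
`B` be the share that `v` gets when `u` is deleted, which does not depend on `y`. If `b u * ψ y >
B`, then `u` is matched by the time `v` has been served (`perturbedGreedy_dominance`), and in every
case `v` gets at least `B` (`perturbedGreedy_sum_increment_anti`). The integral over `y` is then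
bounded by `le_lintegral_threshold`, and this is where the shape of `ψ` enters.

Upper bound: Yao's principle on the upper triangular graph with randomly permuted offline side. A
deterministic strategy cannot distinguish the vertices that are still possible neighbors, so each of
them is equally likely to be matched to the current arrival. What remains is a small linear program
in these probabilities, and a dual solution bounds its value by `(1 - 1/e) * N + 3`
(`sum_card_run_triangular_le`). Letting `N` grow removes the constant. -/

/-- The set of matched offline vertices after the arrivals `l`, if the vertices of `S` are
regarded as matched from the start. -/
def run {m : ℕ} (s : Strategy m) (S : Finset (Fin m)) (l : List (Arrival m)) : Finset (Fin m) :=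
  (l.foldl (step s) ([], S)).2

/-- The set of offline vertices (at most one) that get matched to the arrival `a`, coming after the
arrivals `l`. -/
def increment {m : ℕ} (s : Strategy m) (S : Finset (Fin m)) (l : List (Arrival m))
    (a : Arrival m) : Finset (Fin m) :=
  run s S (l ++ [a]) \ run s S l

/-! ### Runs of an arbitrary online strategy -/

section Run

variable {m : ℕ} (s : Strategy m) (S : Finset (Fin m))

theorem matched_eq_run (l : List (Arrival m)) : matched s l = run s ∅ l := rfl

@[simp] theorem run_nil : run s S [] = S := rfl

theorem foldl_step_fst (l : List (Arrival m)) : (l.foldl (step s) ([], S)).1 = l := by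
  induction l using List.reverseRecOn with
  | nil => rfl
  | append_singleton l a ih => rw [List.foldl_append]; simp [step, ih]

theorem run_concat (l : List (Arrival m)) (a : Arrival m) :
    run s S (l ++ [a]) = match s l (run s S l) a with
      | none => run s S l
      | some u => if u ∈ a.2 ∧ u ∉ run s S l then insert u (run s S l) else run s S l := by
  have h := foldl_step_fst s S l
  unfold run
  rw [List.foldl_append]
  simp only [List.foldl_cons, List.foldl_nil, step, h]

theorem run_concat_cases (l : List (Arrival m)) (a : Arrival m) :
    run s S (l ++ [a]) = run s S l ∨
      ∃ u ∈ a.2, u ∉ run s S l ∧ run s S (l ++ [a]) = insert u (run s S l) := by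
  rw [run_concat]
  split
  · exact Or.inl rfl
  · split_ifs with h
    · exact Or.inr ⟨_, h.1, h.2, rfl⟩
    · exact Or.inl rfl

theorem increment_cases (l : List (Arrival m)) (a : Arrival m) :
    increment s S l a = ∅ ∨ ∃ u ∈ a.2, increment s S l a = {u} := by
  unfold increment
  rcases run_concat_cases s S l a with h | ⟨u, hu, hn, h⟩ <;> rw [h]
  · simp
  · exact Or.inr ⟨u, hu, by ext w; simp; grind⟩

theorem increment_subset (l : List (Arrival m)) (a : Arrival m) : increment s S l a ⊆ a.2 := by
  rcases increment_cases s S l a with h | ⟨u, hu, h⟩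
  · simp [h]
  · simp [h, hu]

theorem card_increment_le_one (l : List (Arrival m)) (a : Arrival m) :
    (increment s S l a).card ≤ 1 := by
  rcases increment_cases s S l a with h | ⟨u, hu, h⟩ <;> simp [h]

theorem run_subset_run_append (l l' : List (Arrival m)) : run s S l ⊆ run s S (l ++ l') := by
  induction l' using List.reverseRecOn with
  | nil => simp
  | append_singleton l' a ih =>
    rw [← List.append_assoc]
    rcases run_concat_cases s S (l ++ l') a with h | ⟨u, -, -, h⟩ <;> rw [h]
    · exact ih
    · exact ih.trans (Finset.subset_insert _ _)

theorem subset_run (l : List (Arrival m)) : S ⊆ run s S l := by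
  simpa using run_subset_run_append s S [] l

theorem sum_run_concat (f : Fin m → ℝ) (l : List (Arrival m)) (a : Arrival m) :
    ∑ u ∈ run s S (l ++ [a]), f u = ∑ u ∈ run s S l, f u + ∑ u ∈ increment s S l a, f u := by
  rw [add_comm, increment, Finset.sum_sdiff (run_subset_run_append s S l [a])]

/-- Each matched vertex is charged to the one arrival that takes it. This converts between weight
per offline vertex and weight per arrival, in both halves of the theorem. -/
theorem sum_run_ofFn (f : Fin m → ℝ) {n : ℕ} (g : Fin n → Arrival m) :
    ∑ u ∈ run s ∅ (List.ofFn g), f u =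
      ∑ t : Fin n, ∑ u ∈ increment s ∅ ((List.ofFn g).take t) (g t), f u := by
  induction n with
  | zero => simp
  | succ n ih =>
    rw [List.ofFn_succ_last, sum_run_concat, ih, Fin.sum_univ_castSucc]
    congr 1
    · refine Finset.sum_congr rfl fun t _ => ?_
      rw [Fin.val_castSucc, List.take_append_of_le_length (by simp [t.2.le])]
    · simp

theorem measurableSet_run_eq {Ω : Type*} [MeasurableSpace Ω] {s : Ω → Strategy m}
    (hs : ∀ past S a u, MeasurableSet {ω | s ω past S a = some u})
    (l : List (Arrival m)) (T : Finset (Fin m)) : MeasurableSet {ω | run (s ω) S l = T} := by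
  induction l using List.reverseRecOn generalizing T with
  | nil => simp
  | append_singleton l a ih =>
    have hs' : ∀ R o, MeasurableSet {ω | s ω l R a = o} := by
      intro R o
      cases o with
      | some u => exact hs l R a u
      | none =>
        have : {ω | s ω l R a = none} = (⋃ u, {ω | s ω l R a = some u})ᶜ := by
          ext ω; simp [Option.eq_none_iff_forall_ne_some]
        rw [this]
        exact (MeasurableSet.iUnion fun u => hs l R a u).compl
    -- Conditioning on the previous state `R` and the answer `o` leaves finitely many cases, in each
    -- of which the new state is deterministic.
    have : {ω | run (s ω) S (l ++ [a]) = T} =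
        ⋃ (R : Finset (Fin m)) (o : Option (Fin m))
          (_ : (match o with
            | none => R
            | some u => if u ∈ a.2 ∧ u ∉ R then insert u R else R) = T),
          {ω | run (s ω) S l = R} ∩ {ω | s ω l R a = o} := by
      ext ω
      simp only [Set.mem_ofPred_eq, run_concat, Set.mem_iUnion, Set.mem_inter_iff, exists_prop]
      constructor
      · intro h
        exact ⟨_, _, h, rfl, rfl⟩
      · rintro ⟨R, o, h, rfl, rfl⟩
        exact h
    rw [this]
    exact MeasurableSet.iUnion fun R => MeasurableSet.iUnion fun o => MeasurableSet.iUnion fun _ =>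
      (ih R).inter (hs' R o)

theorem measurableSet_mem_run {Ω : Type*} [MeasurableSpace Ω] {s : Ω → Strategy m}
    (hs : ∀ past S a u, MeasurableSet {ω | s ω past S a = some u})
    (l : List (Arrival m)) (u : Fin m) : MeasurableSet {ω | u ∈ run (s ω) S l} := by
  have : {ω | u ∈ run (s ω) S l} = ⋃ (T : Finset (Fin m)) (_ : u ∈ T), {ω | run (s ω) S l = T} := by
    ext ω; simp
  rw [this]
  exact MeasurableSet.iUnion fun T => MeasurableSet.iUnion fun _ => measurableSet_run_eq S hs l T

theorem measurableSet_mem_increment {Ω : Type*} [MeasurableSpace Ω] {s : Ω → Strategy m}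
    (hs : ∀ past S a u, MeasurableSet {ω | s ω past S a = some u})
    (l : List (Arrival m)) (a : Arrival m) (u : Fin m) :
    MeasurableSet {ω | u ∈ increment (s ω) S l a} := by
  simp only [increment, Finset.mem_sdiff]
  exact (measurableSet_mem_run S hs _ u).inter (measurableSet_mem_run S hs _ u).compl

/-- The total weight of the matched vertices is measurable, as a function of the random choice. -/
theorem measurable_sum_run {Ω : Type*} [MeasurableSpace Ω] {s : Ω → Strategy m}
    (hs : ∀ past S a u, MeasurableSet {ω | s ω past S a = some u})
    (f : Fin m → ℝ) (l : List (Arrival m)) : Measurable fun ω => ∑ u ∈ run (s ω) S l, f u := by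
  have : (fun ω => ∑ u ∈ run (s ω) S l, f u) =
      fun ω => ∑ u, {ω | u ∈ run (s ω) S l}.indicator (fun _ => f u) ω := by
    ext ω
    simp [Set.indicator_apply, Finset.sum_ite_mem]
  rw [this]
  exact Finset.measurable_sum _ fun u _ =>
    measurable_const.indicator (measurableSet_mem_run S hs l u)

theorem integrable_sum_run {Ω : Type*} [MeasurableSpace Ω] {μ : Measure Ω} [IsFiniteMeasure μ]
    {s : Ω → Strategy m} (hs : ∀ past S a u, MeasurableSet {ω | s ω past S a = some u})
    {f : Fin m → ℝ} (hf : ∀ u, 0 ≤ f u) (l : List (Arrival m)) :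
    Integrable (fun ω => ∑ u ∈ run (s ω) S l, f u) μ := by
  refine Integrable.of_bound (measurable_sum_run S hs f l).aestronglyMeasurable (∑ u, f u)
    (Filter.Eventually.of_forall fun ω => ?_)
  rw [Real.norm_of_nonneg (Finset.sum_nonneg fun u _ => hf u)]
  exact Finset.sum_le_sum_of_subset_of_nonneg (Finset.subset_univ _) fun u _ _ => hf u

end Run

theorem ψ_nonneg (x : unitInterval) : 0 ≤ ψ x := by
  have := Real.exp_le_one_iff.2 (show -(1 - (x : ℝ)) ≤ 0 by linarith [x.2.2])
  unfold ψ
  linarith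

theorem ψ_le_one (x : ℝ) : ψ x ≤ 1 := by
  unfold ψ
  linarith [Real.exp_pos (-(1 - x))]

theorem continuous_ψ : Continuous ψ := by
  unfold ψ
  fun_prop

/-! ### Comparing runs of Perturbed-Greedy with and without a vertex -/

section PerturbedGreedy

variable {m : ℕ} (b : Fin m → ℝ) (x : Fin m → unitInterval) (S : Finset (Fin m))

/-- The interface for comparing two runs: the tie clause determines `p` uniquely, so choices that
are available to both runs and optimal in both must coincide. -/
theorem perturbedGreedy_run_concat (l : List (Arrival m)) (a : Arrival m) :
    (a.2 \ run (perturbedGreedyStrategy b x) S l = ∅ ∧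
      run (perturbedGreedyStrategy b x) S (l ++ [a]) = run (perturbedGreedyStrategy b x) S l) ∨
    ∃ p ∈ a.2 \ run (perturbedGreedyStrategy b x) S l,
      run (perturbedGreedyStrategy b x) S (l ++ [a]) =
        insert p (run (perturbedGreedyStrategy b x) S l) ∧
      ∀ w ∈ a.2 \ run (perturbedGreedyStrategy b x) S l,
        b w * ψ (x w) ≤ b p * ψ (x p) ∧ (b w * ψ (x w) = b p * ψ (x p) → p ≤ w) := by
  rw [run_concat]
  generalize run (perturbedGreedyStrategy b x) S l = R
  rcases (a.2 \ R).eq_empty_or_nonempty with h | h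
  · left
    have : ¬ (maximizers b x (a.2 \ R)).Nonempty := by simp [h, maximizers]
    simp only [perturbedGreedyStrategy, dif_neg this]
    exact ⟨h, trivial⟩
  · right
    have hne : (maximizers b x (a.2 \ R)).Nonempty := by
      obtain ⟨p, hp, hmax⟩ := Finset.exists_max_image _ (fun u => b u * ψ (x u)) h
      exact ⟨p, by simpa only [maximizers, Finset.mem_filter] using ⟨hp, hmax⟩⟩
    have hmem := Finset.min'_mem _ hne
    have hmin : ∀ w ∈ maximizers b x (a.2 \ R), (maximizers b x (a.2 \ R)).min' hne ≤ w :=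
      fun w hw => Finset.min'_le _ w hw
    have hs : perturbedGreedyStrategy b x l R a =
        some ((maximizers b x (a.2 \ R)).min' hne) := by
      simp only [perturbedGreedyStrategy, dif_pos hne]
    rw [hs]
    generalize (maximizers b x (a.2 \ R)).min' hne = p at hmem hmin
    simp only [maximizers, Finset.mem_filter] at hmem hmin
    refine ⟨p, hmem.1, ?_, fun w hw => ⟨hmem.2 w hw, fun he => hmin w ⟨hw, ?_⟩⟩⟩
    · simp only
      rw [if_pos (Finset.mem_sdiff.1 hmem.1)]
    · intro z hz
      rw [he]
      exact hmem.2 z hz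

variable {S} {T : Finset (Fin m)}

/-- Fewer vertices that are matched at the start lead to fewer vertices that are matched later. -/
theorem perturbedGreedy_run_mono (hST : S ⊆ T) (l : List (Arrival m)) :
    run (perturbedGreedyStrategy b x) S l ⊆ run (perturbedGreedyStrategy b x) T l := by
  induction l using List.reverseRecOn with
  | nil => simpa
  | append_singleton l a ih =>
    have hT := run_subset_run_append (perturbedGreedyStrategy b x) T l [a]
    rcases perturbedGreedy_run_concat b x S l a with ⟨-, h⟩ | ⟨p, hp, h, hmax⟩
    · rw [h]; exact ih.trans hT
    · rw [h]
      refine Finset.insert_subset ?_ (ih.trans hT)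
      by_contra hpT
      have hpT' : p ∈ a.2 \ run (perturbedGreedyStrategy b x) T l :=
        Finset.mem_sdiff.2 ⟨(Finset.mem_sdiff.1 hp).1, fun h => hpT (hT h)⟩
      rcases perturbedGreedy_run_concat b x T l a with ⟨h', -⟩ | ⟨q, hq, h', hmax'⟩
      · simp [h'] at hpT'
      -- `p` is free in the run from `T` and, by induction, `q` is free in the run from `S`. Each is
      -- at least as good as the other, so the tie rule forces `p = q`.
      · have h1 := hmax' p hpT'
        have h2 := hmax q (Finset.sdiff_subset_sdiff subset_rfl ih hq)
        have he := le_antisymm h1.1 h2.1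
        have : p = q := le_antisymm (h2.2 he.symm) (h1.2 he)
        exact hpT (by rw [h', this]; exact Finset.mem_insert_self _ _)

theorem sum_perturbed_weight_nonneg (hb : ∀ u, 0 ≤ b u) (U : Finset (Fin m)) :
    0 ≤ ∑ w ∈ U, b w * ψ (x w) :=
  Finset.sum_nonneg fun w _ => mul_nonneg (hb w) (ψ_nonneg _)

theorem perturbedGreedy_increment_eq {R : Finset (Fin m)} {l : List (Arrival m)} {a : Arrival m}
    {p : Fin m} (hp : p ∈ a.2 \ run (perturbedGreedyStrategy b x) R l)
    (h : run (perturbedGreedyStrategy b x) R (l ++ [a]) =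
      insert p (run (perturbedGreedyStrategy b x) R l)) :
    increment (perturbedGreedyStrategy b x) R l a = {p} := by
  have := (Finset.mem_sdiff.1 hp).2
  unfold increment
  rw [h]
  ext w
  simp only [Finset.mem_sdiff, Finset.mem_insert, Finset.mem_singleton]
  grind

/-- Any free neighbor has at most the perturbed weight of the vertex that is chosen. -/
theorem perturbedGreedy_le_sum_increment {R : Finset (Fin m)} {l : List (Arrival m)}
    {a : Arrival m} {w : Fin m} (hw : w ∈ a.2 \ run (perturbedGreedyStrategy b x) R l) :
    b w * ψ (x w) ≤ ∑ z ∈ increment (perturbedGreedyStrategy b x) R l a, b z * ψ (x z) := by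
  rcases perturbedGreedy_run_concat b x R l a with ⟨h, -⟩ | ⟨p, hp, h, hmax⟩
  · simp [h] at hw
  · rw [perturbedGreedy_increment_eq b x hp h, Finset.sum_singleton]
    exact (hmax w hw).1

/-- The vertex chosen in the run from `T` is also free in the run from `S`, by monotonicity. With `S
= ∅` and `T = {u}` this says that the presence of `u` never lowers an arrival's share. -/
theorem perturbedGreedy_sum_increment_anti (hb : ∀ u, 0 ≤ b u) (hST : S ⊆ T)
    (l : List (Arrival m)) (a : Arrival m) :
    ∑ w ∈ increment (perturbedGreedyStrategy b x) T l a, b w * ψ (x w) ≤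
      ∑ w ∈ increment (perturbedGreedyStrategy b x) S l a, b w * ψ (x w) := by
  rcases perturbedGreedy_run_concat b x T l a with ⟨-, h⟩ | ⟨q, hq, h, -⟩
  · unfold increment at *
    rw [h, Finset.sdiff_self, Finset.sum_empty]
    exact sum_perturbed_weight_nonneg b x hb _
  · rw [perturbedGreedy_increment_eq b x hq h, Finset.sum_singleton]
    exact perturbedGreedy_le_sum_increment b x
      (Finset.sdiff_subset_sdiff subset_rfl (perturbedGreedy_run_mono b x hST l) hq)

/-- As long as `u` is not matched, removing it does not change how the other vertices are
matched. -/
theorem perturbedGreedy_run_singleton {u : Fin m} {l : List (Arrival m)}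
    (hu : u ∉ run (perturbedGreedyStrategy b x) ∅ l) :
    run (perturbedGreedyStrategy b x) {u} l = insert u (run (perturbedGreedyStrategy b x) ∅ l) := by
  induction l using List.reverseRecOn with
  | nil => rfl
  | append_singleton l a ih =>
    have ih := ih fun h => hu (run_subset_run_append _ _ l [a] h)
    rcases perturbedGreedy_run_concat b x ∅ l a with ⟨h0, h⟩ | ⟨p, hp, h, hmax⟩ <;>
      rcases perturbedGreedy_run_concat b x {u} l a with ⟨h0', h'⟩ | ⟨q, hq, h', hmax'⟩
    · rw [h, h', ih]
    · exfalso
      have : q ∈ a.2 \ run (perturbedGreedyStrategy b x) ∅ l :=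
        Finset.sdiff_subset_sdiff subset_rfl
          (perturbedGreedy_run_mono b x (Finset.empty_subset _) l) hq
      simp [h0] at this
    · exfalso
      have : p ∈ a.2 \ run (perturbedGreedyStrategy b x) {u} l := by
        rw [ih]
        rw [h] at hu
        grind
      simp [h0'] at this
    · have hp' : p ∈ a.2 \ run (perturbedGreedyStrategy b x) {u} l := by
        rw [ih]
        rw [h] at hu
        grind
      have h1 := hmax' p hp'
      have h2 := hmax q (Finset.sdiff_subset_sdiff subset_rfl
          (perturbedGreedy_run_mono b x (Finset.empty_subset _) l) hq)
      have he := le_antisymm h1.1 h2.1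
      have : p = q := le_antisymm (h2.2 he.symm) (h1.2 he)
      rw [h, h', ih, this, Finset.insert_comm]

/-- A neighbor whose perturbed weight exceeds what the arrival obtains without it gets matched. -/
theorem perturbedGreedy_dominance {u : Fin m} {l : List (Arrival m)} {a : Arrival m}
    (hua : u ∈ a.2)
    (hlt : ∑ w ∈ increment (perturbedGreedyStrategy b x) {u} l a, b w * ψ (x w) <
      b u * ψ (x u)) :
    u ∈ run (perturbedGreedyStrategy b x) ∅ (l ++ [a]) := by
  by_contra hu
  have hul : u ∉ run (perturbedGreedyStrategy b x) ∅ l :=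
    fun h => hu (run_subset_run_append _ _ l [a] h)
  have hu' : u ∈ a.2 \ run (perturbedGreedyStrategy b x) ∅ l := Finset.mem_sdiff.2 ⟨hua, hul⟩
  rcases perturbedGreedy_run_concat b x ∅ l a with ⟨h, -⟩ | ⟨p, hp, h, hmax⟩
  · simp [h] at hu'
  -- Before `a` the two runs differ only in `u`, and `p ≠ u`. So `p` is available without `u` too,
  -- although its perturbed weight is at least that of `u`.
  · have hp' : p ∈ a.2 \ run (perturbedGreedyStrategy b x) {u} l := by
      rw [perturbedGreedy_run_singleton b x hul]
      rw [h] at hu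
      grind
    exact absurd ((hmax u hu').1.trans (perturbedGreedy_le_sum_increment b x hp')) (not_le.2 hlt)

/-- The number drawn for a vertex that is matched from the start has no influence. -/
theorem perturbedGreedy_run_update {u : Fin m} (hu : u ∈ S) (y : unitInterval)
    (l : List (Arrival m)) :
    run (perturbedGreedyStrategy b (Function.update x u y)) S l =
      run (perturbedGreedyStrategy b x) S l := by
  induction l using List.reverseRecOn with
  | nil => rfl
  | append_singleton l a ih =>
    have huR := subset_run (perturbedGreedyStrategy b x) S l hu
    rw [run_concat, run_concat, ih]
    generalize run (perturbedGreedyStrategy b x) S l = R at huR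
    have hmax : maximizers b (Function.update x u y) (a.2 \ R) = maximizers b x (a.2 \ R) := by
      have hne : ∀ w ∈ a.2 \ R, Function.update x u y w = x w := fun w hw =>
        Function.update_of_ne (by rintro rfl; exact (Finset.mem_sdiff.1 hw).2 huR) _ _
      unfold maximizers
      refine Finset.filter_congr fun w hw => ?_
      rw [hne w hw]
      exact forall₂_congr fun z hz => by rw [hne z hz]
    have hs : perturbedGreedyStrategy b (Function.update x u y) l R a =
        perturbedGreedyStrategy b x l R a := by
      simp only [perturbedGreedyStrategy, hmax]
    rw [hs]

/-- This makes the threshold `B` a constant while `x u` is integrated out. -/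
theorem perturbedGreedy_sum_increment_update (u : Fin m) (y : unitInterval)
    (l : List (Arrival m)) (a : Arrival m) :
    ∑ w ∈ increment (perturbedGreedyStrategy b (Function.update x u y)) {u} l a,
        b w * ψ (Function.update x u y w) =
      ∑ w ∈ increment (perturbedGreedyStrategy b x) {u} l a, b w * ψ (x w) := by
  unfold increment
  rw [perturbedGreedy_run_update b x (Finset.mem_singleton_self u),
    perturbedGreedy_run_update b x (Finset.mem_singleton_self u)]
  refine Finset.sum_congr rfl fun w hw => ?_
  rw [Function.update_of_ne]
  rintro rfl
  exact (Finset.mem_sdiff.1 hw).2 (subset_run _ _ l (Finset.mem_singleton_self w))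

end PerturbedGreedy

/-! ### Expected dual value of an edge -/

/-- The dual value of an edge in terms of the random number `y` of its offline endpoint `u` of
weight `b`, when the online endpoint obtains `B` without `u`. -/
theorem le_lintegral_threshold {b B : ℝ} (hb : 0 ≤ b) (hB : 0 ≤ B) :
    ENNReal.ofReal ((1 - 1 / Real.exp 1) * b) ≤
      ∫⁻ y : unitInterval,
        ENNReal.ofReal ((if B < b * ψ y then b * (1 - ψ y) else 0) + B) := by
  have hnn : ∀ y : ℝ, 0 ≤ if B < b * ψ y then b * (1 - ψ y) else 0 := fun y => by
    split_ifs
    · exact mul_nonneg hb (by linarith [ψ_le_one y])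
    · exact le_rfl
  -- Since `1 - 1/e = ψ 0`, a larger `B` is never exceeded by `b * ψ y`, but then `B` alone
  -- suffices.
  rcases le_or_gt ((1 - 1 / Real.exp 1) * b) B with h | h
  · calc ENNReal.ofReal ((1 - 1 / Real.exp 1) * b) ≤ ENNReal.ofReal B :=
          ENNReal.ofReal_le_ofReal h
      _ = ∫⁻ _ : unitInterval, ENNReal.ofReal B := by simp
      _ ≤ _ := lintegral_mono fun y => ENNReal.ofReal_le_ofReal (by linarith [hnn y])
  · have he := Real.exp_pos 1
    have hb' : 0 < b := by
      rcases hb.eq_or_lt with h0 | h0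
      · rw [← h0] at h; linarith
      · exact h0
    have hBb : B / b < 1 - 1 / Real.exp 1 := (div_lt_iff₀ hb').2 h
    have hpos : 0 < 1 - B / b := by
      have : 0 < 1 / Real.exp 1 := by positivity
      linarith
    -- The critical value: `c` solves `b * ψ c = B`, and `ψ` is decreasing.
    set c := 1 + Real.log (1 - B / b) with hc
    have hc0 : 0 ≤ c := by
      have : Real.log (Real.exp (-1)) ≤ Real.log (1 - B / b) :=
        Real.log_le_log (Real.exp_pos _) (by rw [Real.exp_neg, ← one_div]; linarith)
      rw [Real.log_exp] at this
      linarith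
    have hc1 : c ≤ 1 := by
      have := Real.log_nonpos hpos.le (by have := div_nonneg hB hb; linarith)
      linarith
    have hexp : Real.exp (c - 1) = 1 - B / b := by
      rw [hc, add_sub_cancel_left, Real.exp_log hpos]
    have hlt : ∀ y < c, B < b * ψ y := fun y hy => by
      have h1 : Real.exp (-(1 - y)) < 1 - B / b := by
        rw [← hexp]; exact Real.exp_lt_exp.2 (by linarith)
      have h2 : b * (B / b) = B := mul_div_cancel₀ _ hb'.ne'
      unfold ψ
      nlinarith
    -- `1 - ψ y = exp (y - 1)` is its own antiderivative, so the first term integrates to `b * (1 -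
    -- B / b) - b / e`. Adding `B` cancels the dependence on the threshold.
    have hint : ∫ y : unitInterval, ((Set.Ioo 0 c).indicator (fun y => b * Real.exp (y - 1)) y + B)
        = (1 - 1 / Real.exp 1) * b := by
      rw [integral_subtype (s := Set.Icc (0 : ℝ) 1) measurableSet_Icc
        (fun y : ℝ => (Set.Ioo 0 c).indicator (fun y => b * Real.exp (y - 1)) y + B)]
      have hcont : Continuous fun y : ℝ => b * Real.exp (y - 1) := by fun_prop
      rw [integral_add ((hcont.integrableOn_Icc).indicator measurableSet_Ioo) (by simp),
        setIntegral_indicator measurableSet_Ioo]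
      have : Set.Icc (0 : ℝ) 1 ∩ Set.Ioo 0 c = Set.Ioo 0 c :=
        Set.inter_eq_right.2 fun y hy => ⟨hy.1.le, hy.2.le.trans hc1⟩
      rw [this, ← integral_Ioc_eq_integral_Ioo, ← intervalIntegral.integral_of_le hc0]
      have hd : ∫ y in (0 : ℝ)..c, b * Real.exp (y - 1) = b * Real.exp (c - 1) -
          b * Real.exp (0 - 1) := by
        refine intervalIntegral.integral_eq_sub_of_hasDerivAt
          (f := fun y => b * Real.exp (y - 1)) (fun y _ => ?_)
          (hcont.intervalIntegrable _ _)
        simpa using (((hasDerivAt_id y).sub_const 1).exp).const_mul b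
      rw [hd, hexp, zero_sub, Real.exp_neg]
      simp
      field_simp
      ring
    have hle : ∀ y : unitInterval, (Set.Ioo 0 c).indicator (fun y => b * Real.exp (y - 1)) (y : ℝ)
        + B ≤ (if B < b * ψ y then b * (1 - ψ y) else 0) + B := fun y => by
      refine add_le_add_left ?_ B
      refine Set.indicator_apply_le' (fun hy => ?_) fun _ => hnn y
      rw [if_pos (hlt _ hy.2)]
      unfold ψ
      rw [sub_sub_cancel, neg_sub]
    rw [← hint]
    rw [ofReal_integral_eq_lintegral_ofReal]
    · exact lintegral_mono fun y => ENNReal.ofReal_le_ofReal (hle y)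
    · refine Integrable.of_bound (C := b + B) (Measurable.aestronglyMeasurable ?_)
        (Filter.Eventually.of_forall fun y => ?_)
      · exact ((Measurable.indicator (by fun_prop) measurableSet_Ioo).comp
          measurable_subtype_coe).add_const _
      · rw [Real.norm_of_nonneg (add_nonneg (Set.indicator_nonneg (fun _ _ => by positivity) _) hB)]
        refine add_le_add_left (Set.indicator_apply_le' (fun _ => ?_) fun _ => hb) B
        exact mul_le_of_le_one_right hb (Real.exp_le_one_iff.2 (by linarith [y.2.2]))
    · exact Filter.Eventually.of_forall fun y =>
        add_nonneg (Set.indicator_nonneg (fun _ _ => by positivity) _) hB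

theorem measurableSet_perturbedGreedyStrategy {m : ℕ} (b : Fin m → ℝ) (past : List (Arrival m))
    (S : Finset (Fin m)) (a : Arrival m) (u : Fin m) :
    MeasurableSet {x | perturbedGreedyStrategy b x past S a = some u} :=
  (perturbedGreedy m b).measurable_strategy past S a u

/-- The dual value of an edge between `u` and the arrival `a` in the run of Perturbed-Greedy with
the random numbers `x` on the sequence `L`, in which `a` comes after `l`. -/
def edgeValue {m : ℕ} (b : Fin m → ℝ) (L l : List (Arrival m)) (a : Arrival m) (u : Fin m)
    (x : Fin m → unitInterval) : ℝ :=
  (if u ∈ run (perturbedGreedyStrategy b x) ∅ L then b u * (1 - ψ (x u)) else 0) +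
    ∑ w ∈ increment (perturbedGreedyStrategy b x) ∅ l a, b w * ψ (x w)

section EdgeValue

variable {m : ℕ} (b : Fin m → ℝ)

theorem edgeValue_nonneg (hb : ∀ u, 0 ≤ b u) (L l : List (Arrival m)) (a : Arrival m) (u : Fin m)
    (x : Fin m → unitInterval) : 0 ≤ edgeValue b L l a u x := by
  refine add_nonneg ?_ (sum_perturbed_weight_nonneg b x hb _)
  split_ifs
  · exact mul_nonneg (hb u) (by linarith [ψ_le_one (x u)])
  · exact le_rfl

theorem measurable_edgeValue (L l : List (Arrival m)) (a : Arrival m) (u : Fin m) :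
    Measurable (edgeValue b L l a u) := by
  have hs := measurableSet_perturbedGreedyStrategy b
  have hψ := continuous_ψ.measurable
  have hsum : (fun x => ∑ w ∈ increment (perturbedGreedyStrategy b x) ∅ l a, b w * ψ (x w)) =
      fun x => ∑ w, {x | w ∈ increment (perturbedGreedyStrategy b x) ∅ l a}.indicator
        (fun x => b w * ψ (x w)) x := by
    ext x
    simp [Set.indicator_apply, Finset.sum_ite_mem]
  refine Measurable.add (Measurable.ite (measurableSet_mem_run ∅ hs L u) ?_ measurable_const) ?_
  · fun_prop
  · rw [hsum]
    refine Finset.measurable_sum _ fun w _ => Measurable.indicator ?_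
      (measurableSet_mem_increment ∅ hs l a w)
    fun_prop

theorem le_lintegral_edgeValue (hb : ∀ u, 0 ≤ b u) (l l' : List (Arrival m)) {a : Arrival m}
    {u : Fin m} (hu : u ∈ a.2) :
    ENNReal.ofReal ((1 - 1 / Real.exp 1) * b u) ≤
      ∫⁻ x, ENNReal.ofReal (edgeValue b (l ++ [a] ++ l') l a u x)
        ∂(Measure.pi fun _ : Fin m => (volume : Measure unitInterval)) := by
  classical
  have hconst : ENNReal.ofReal ((1 - 1 / Real.exp 1) * b u) =
      ∫⁻ _, ENNReal.ofReal ((1 - 1 / Real.exp 1) * b u)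
        ∂(Measure.pi fun _ : Fin m => (volume : Measure unitInterval)) := by simp
  rw [hconst]
  -- It suffices to compare the integrals over `x u` alone, with the other numbers fixed.
  refine lintegral_le_of_lmarginal_le {u} measurable_const
    (measurable_edgeValue b _ l a u).ennreal_ofReal ?_
  rw [lmarginal_singleton, lmarginal_singleton]
  intro x
  simp only [lintegral_const, measure_univ, mul_one]
  refine (le_lintegral_threshold (hb u) (sum_perturbed_weight_nonneg b x hb
    (increment (perturbedGreedyStrategy b x) {u} l a))).trans
      (lintegral_mono fun y => ENNReal.ofReal_le_ofReal ?_)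
  rw [← perturbedGreedy_sum_increment_update b x u y l a]
  set x' := Function.update x u y with hx'
  have hx'u : x' u = y := Function.update_self ..
  unfold edgeValue
  refine add_le_add ?_ (perturbedGreedy_sum_increment_anti b x' hb (Finset.empty_subset _) l a)
  rw [← hx'u]
  by_cases h : ∑ w ∈ increment (perturbedGreedyStrategy b x') {u} l a, b w * ψ (x' w) <
      b u * ψ (x' u)
  · rw [if_pos h, if_pos (run_subset_run_append _ _ _ l' (perturbedGreedy_dominance b x' hu h))]
  · rw [if_neg h]
    split_ifs
    · exact mul_nonneg (hb u) (by linarith [ψ_le_one (x' u)])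
    · exact le_rfl

end EdgeValue

/-! ### Summing over a matching: the lower bound -/

theorem mem_matchings {m n : ℕ} {E M : Finset (Fin m × Fin n)} :
    M ∈ matchings E ↔ M ⊆ E ∧ IsMatching M := by
  simp [matchings]

theorem expectedGain_nonneg (A : RandomizedAlgorithm.{u}) (I : Input) : 0 ≤ expectedGain A I :=
  integral_nonneg fun _ => Finset.sum_nonneg fun u _ => I.b_nonneg u

/-- Every matching is worth at most the gain of Perturbed-Greedy divided by `1 - 1/e`. -/
theorem IsMatching.le_expectedGain_perturbedGreedy (I : Input) {M : Finset (Fin I.m × Fin I.n)}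
    (hM : IsMatching M) (hME : M ⊆ I.E) :
    (1 - 1 / Real.exp 1) * ∑ e ∈ M, I.b e.1 ≤ expectedGain perturbedGreedy I := by
  set f : Fin I.n → Arrival I.m := fun t => ((I.π t : ℕ), I.nbrs (I.π t)) with hf
  have hL : I.arrivals = List.ofFn f := rfl
  set μ := Measure.pi fun _ : Fin I.m => (volume : Measure unitInterval)
  set V : Fin I.m × Fin I.n → (Fin I.m → unitInterval) → ℝ := fun e =>
    edgeValue I.b I.arrivals (I.arrivals.take (I.π.symm e.2)) (f (I.π.symm e.2)) e.1
  have hedge : ∀ e ∈ M, ENNReal.ofReal ((1 - 1 / Real.exp 1) * I.b e.1) ≤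
      ∫⁻ x, ENNReal.ofReal (V e x) ∂μ := fun e he => by
    have hlt : (I.π.symm e.2 : ℕ) < I.arrivals.length := by simp [hL]
    have hget : I.arrivals[(I.π.symm e.2 : ℕ)] = f (I.π.symm e.2) := by simp [hL]
    have := le_lintegral_edgeValue I.b I.b_nonneg (I.arrivals.take (I.π.symm e.2))
      (I.arrivals.drop (I.π.symm e.2 + 1)) (a := f (I.π.symm e.2)) (u := e.1)
      (by simp [hf, Input.nbrs, hME he])
    have hsplit : I.arrivals.take (I.π.symm e.2) ++ [f (I.π.symm e.2)] ++
        I.arrivals.drop (I.π.symm e.2 + 1) = I.arrivals := by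
      rw [← hget, List.take_append_getElem, List.take_append_drop]
    rwa [hsplit] at this
  -- A matching uses the share of each offline vertex and of each arrival at most once, and the two
  -- shares created by a matched vertex add up to its weight.
  have hpoint : ∀ x, ∑ e ∈ M, V e x ≤
      ∑ u ∈ matched (perturbedGreedyStrategy I.b x) I.arrivals, I.b u := fun x => by
    have hα : ∑ e ∈ M, (if e.1 ∈ run (perturbedGreedyStrategy I.b x) ∅ I.arrivals then
        I.b e.1 * (1 - ψ (x e.1)) else 0) ≤
        ∑ u ∈ run (perturbedGreedyStrategy I.b x) ∅ I.arrivals, I.b u * (1 - ψ (x u)) := by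
      have hinj : Set.InjOn Prod.fst (M : Set (Fin I.m × Fin I.n)) := fun e he e' he' h =>
        hM e he e' he' (Or.inl h)
      rw [← Finset.sum_image (g := Prod.fst) (f := fun u =>
        if u ∈ run (perturbedGreedyStrategy I.b x) ∅ I.arrivals then
          I.b u * (1 - ψ (x u)) else 0) hinj, Finset.sum_ite_mem]
      exact Finset.sum_le_sum_of_subset_of_nonneg Finset.inter_subset_right fun u _ _ =>
        mul_nonneg (I.b_nonneg u) (by linarith [ψ_le_one (x u)])
    have hβ : ∑ e ∈ M, ∑ w ∈ increment (perturbedGreedyStrategy I.b x) ∅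
          (I.arrivals.take (I.π.symm e.2)) (f (I.π.symm e.2)), I.b w * ψ (x w) ≤
        ∑ u ∈ run (perturbedGreedyStrategy I.b x) ∅ I.arrivals, I.b u * ψ (x u) := by
      have hinj : Set.InjOn (fun e => I.π.symm e.2) (M : Set (Fin I.m × Fin I.n)) :=
        fun e he e' he' h => hM e he e' he' (Or.inr (I.π.symm.injective h))
      rw [← Finset.sum_image (g := fun e : Fin I.m × Fin I.n => I.π.symm e.2) (f := fun t : Fin I.n =>
        ∑ w ∈ increment (perturbedGreedyStrategy I.b x) ∅ (I.arrivals.take t) (f t),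
          I.b w * ψ (x w)) hinj]
      conv_rhs => rw [hL, sum_run_ofFn _ (fun u => I.b u * ψ (x u))]
      exact Finset.sum_le_sum_of_subset_of_nonneg (Finset.subset_univ _) fun t _ _ =>
        sum_perturbed_weight_nonneg I.b x I.b_nonneg _
    calc ∑ e ∈ M, V e x ≤ _ := by
          simp only [V, edgeValue, Finset.sum_add_distrib]
          exact add_le_add hα hβ
      _ = _ := by
          rw [← Finset.sum_add_distrib, matched_eq_run]
          exact Finset.sum_congr rfl fun u _ => by ring
  have hF : 0 ≤ 1 - 1 / Real.exp 1 := by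
    have := Real.one_lt_exp_iff.2 one_pos
    rw [sub_nonneg, div_le_one (by positivity)]
    exact this.le
  rw [← ENNReal.ofReal_le_ofReal_iff (expectedGain_nonneg _ I), Finset.mul_sum,
    ENNReal.ofReal_sum_of_nonneg fun e _ => mul_nonneg hF (I.b_nonneg _)]
  calc ∑ e ∈ M, ENNReal.ofReal ((1 - 1 / Real.exp 1) * I.b e.1)
      ≤ ∑ e ∈ M, ∫⁻ x, ENNReal.ofReal (V e x) ∂μ := Finset.sum_le_sum hedge
    _ = ∫⁻ x, ∑ e ∈ M, ENNReal.ofReal (V e x) ∂μ :=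
        (lintegral_finsetSum _ fun e _ => (measurable_edgeValue I.b _ _ _ _).ennreal_ofReal).symm
    _ ≤ ∫⁻ x, ENNReal.ofReal
          (∑ u ∈ matched (perturbedGreedyStrategy I.b x) I.arrivals, I.b u) ∂μ :=
        lintegral_mono fun x => by
          rw [← ENNReal.ofReal_sum_of_nonneg fun e _ => edgeValue_nonneg I.b I.b_nonneg _ _ _ _ _]
          exact ENNReal.ofReal_le_ofReal (hpoint x)
    _ = ENNReal.ofReal (expectedGain perturbedGreedy I) :=
        (ofReal_integral_eq_lintegral_ofReal
          (integrable_sum_run ∅ (measurableSet_perturbedGreedyStrategy I.b) I.b_nonneg I.arrivals)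
          (Filter.Eventually.of_forall fun _ => Finset.sum_nonneg fun u _ => I.b_nonneg u)).symm

theorem le_competitiveRatio_perturbedGreedy :
    ((1 - 1 / Real.exp 1 : ℝ) : EReal) ≤ competitiveRatio perturbedGreedy := by
  refine le_iInf₂ fun I hI => EReal.coe_le_coe_iff.2 ?_
  rw [le_div_iff₀ hI]
  obtain ⟨M, hM, hopt⟩ := Finset.exists_mem_eq_sup' (matchings_nonempty I.E)
    (fun M => ∑ e ∈ M, I.b e.1)
  rw [mem_matchings] at hM
  rw [Input.opt, hopt]
  exact hM.2.le_expectedGain_perturbedGreedy I hM.1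

/-! ### Symmetry of the randomly permuted triangular instance -/

section UpperTriangular

variable {n : ℕ}

/-- The `t`-th arrival of the upper triangular instance: its neighbors are the vertices
whose position is at least `t`. -/
def triangularArrival (σ : Equiv.Perm (Fin n)) (t : Fin n) : Arrival n :=
  (t, Finset.univ.filter fun u => t ≤ σ.symm u)

theorem mem_triangularArrival {σ : Equiv.Perm (Fin n)} {t u : Fin n} :
    u ∈ (triangularArrival σ t).2 ↔ t ≤ σ.symm u := by
  simp [triangularArrival]

/-- The upper triangular instance, with the offline vertices permuted by `σ`. -/
def triangularInput (σ : Equiv.Perm (Fin n)) : Input where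
  m := n
  n := n
  b := fun _ => 1
  b_nonneg := fun _ => zero_le_one
  E := Finset.univ.filter fun e => e.2 ≤ σ.symm e.1
  π := Equiv.refl _

theorem triangularInput_arrivals (σ : Equiv.Perm (Fin n)) :
    (triangularInput σ).arrivals = List.ofFn (triangularArrival σ) := by
  unfold Input.arrivals
  congr 1
  funext t
  ext u
  · rfl
  · exact (Finset.mem_filter.trans (and_iff_right (Finset.mem_univ _))).trans
      ((Finset.mem_filter.trans (and_iff_right (Finset.mem_univ _))).trans
        mem_triangularArrival.symm)

theorem le_opt_triangularInput (σ : Equiv.Perm (Fin n)) : (n : ℝ) ≤ (triangularInput σ).opt := by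
  have hinj : Function.Injective fun t : Fin n => (σ t, t) := fun t t' h => (Prod.ext_iff.1 h).2
  have hM : Finset.univ.image (fun t : Fin n => (σ t, t)) ∈ matchings (triangularInput σ).E := by
    refine mem_matchings.2 ⟨?_, ?_⟩
    · intro e he
      obtain ⟨t, -, rfl⟩ := Finset.mem_image.1 he
      exact Finset.mem_filter.2 ⟨Finset.mem_univ _, (σ.symm_apply_apply t).ge⟩
    · intro e he f hf h
      obtain ⟨t, -, rfl⟩ := Finset.mem_image.1 he
      obtain ⟨t', -, rfl⟩ := Finset.mem_image.1 hf
      rcases h with h | h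
      · rw [σ.injective h]
      · simp only at h
        rw [h]
  refine le_trans ?_ (Finset.le_sup' (fun M => ∑ e ∈ M, (triangularInput σ).b e.1) hM)
  simp [triangularInput, Finset.card_image_of_injective _ hinj]

/-- The set of vertices that are matched to the `t`-th arrival of the upper triangular
instance. -/
def triangularIncrement (s : Strategy n) (σ : Equiv.Perm (Fin n)) (t : Fin n) : Finset (Fin n) :=
  increment s ∅ ((List.ofFn (triangularArrival σ)).take t) (triangularArrival σ t)

theorem triangularArrival_mul_swap (σ : Equiv.Perm (Fin n)) {i j k : Fin n} (hj : i ≤ j)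
    (hk : i ≤ k) : triangularArrival (σ * Equiv.swap j k) i = triangularArrival σ i := by
  have : ∀ w, i ≤ Equiv.swap j k w ↔ i ≤ w := fun w => by
    rw [Equiv.swap_apply_def]
    split_ifs with h h'
    · simp [h, hj, hk]
    · simp [h', hj, hk]
    · rfl
  ext u
  · rfl
  · simp only [triangularArrival, Finset.mem_filter, Finset.mem_univ, true_and]
    exact this (σ.symm u)

/-- Positions `j, k ≥ t` are interchangeable in everything revealed up to time `t`, so the strategy
has seen the same input. -/
theorem triangularIncrement_mul_swap (s : Strategy n) (σ : Equiv.Perm (Fin n)) {t j k : Fin n}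
    (hj : t ≤ j) (hk : t ≤ k) :
    triangularIncrement s (σ * Equiv.swap j k) t = triangularIncrement s σ t := by
  unfold triangularIncrement
  rw [triangularArrival_mul_swap σ hj hk]
  congr 1
  refine List.ext_getElem (by simp) fun i h1 h2 => ?_
  have hi : i < t := by
    simp only [List.length_take, lt_min_iff] at h1
    exact h1.1
  simp only [List.getElem_take, List.getElem_ofFn]
  have : (⟨i, hi.trans t.2⟩ : Fin n) ≤ t := Fin.le_def.2 hi.le
  exact triangularArrival_mul_swap σ (this.trans hj) (this.trans hk)

/-- All vertices that are still possible neighbors are matched to the `t`-th arrival with the same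
frequency. -/
theorem sum_triangularIncrement_eq (s : Strategy n) {t j k : Fin n} (hj : t ≤ j) (hk : t ≤ k) :
    (∑ σ : Equiv.Perm (Fin n), if σ j ∈ triangularIncrement s σ t then (1 : ℝ) else 0) =
      ∑ σ : Equiv.Perm (Fin n), if σ k ∈ triangularIncrement s σ t then (1 : ℝ) else 0 := by
  rw [← Equiv.sum_comp (Equiv.mulRight (Equiv.swap j k))]
  refine Finset.sum_congr rfl fun σ _ => ?_
  refine if_congr ?_ rfl rfl
  rw [Equiv.coe_mulRight, triangularIncrement_mul_swap s σ hj hk, Equiv.Perm.mul_apply,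
    Equiv.swap_apply_left]

theorem card_triangularIncrement (s : Strategy n) (σ : Equiv.Perm (Fin n)) (t : Fin n) :
    ((triangularIncrement s σ t).card : ℝ) =
      ∑ j ∈ Finset.Ici t, if σ j ∈ triangularIncrement s σ t then (1 : ℝ) else 0 := by
  have h1 : ((triangularIncrement s σ t).card : ℝ) =
      ∑ j, if σ j ∈ triangularIncrement s σ t then (1 : ℝ) else 0 := by
    rw [Equiv.sum_comp σ fun u => if u ∈ triangularIncrement s σ t then (1 : ℝ) else 0]
    simp
  rw [h1]
  refine (Finset.sum_subset (Finset.subset_univ _) fun j _ hj => if_neg fun h => hj ?_).symm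
  have := increment_subset _ _ _ _ h
  simpa [triangularArrival] using this

end UpperTriangular

/-! ### The linear program and its asymptotics -/

/-- The left side, a dual objective value, equals `N - K * (H_N - H_K)` with harmonic numbers `H`.
Each increment of the logarithm is at most the corresponding harmonic term. -/
theorem add_sum_max_le {K N : ℕ} (h : K ≤ N) :
    (K : ℝ) + ∑ k ∈ Finset.range N, max 0 (1 - (K : ℝ) / (k + 1)) ≤
      N - K * (Real.log (N + 1) - Real.log (K + 1)) := by
  induction N, h using Nat.le_induction with
  | base =>
    rw [Finset.sum_eq_zero]
    · simp
    · intro k hk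
      have hk' : (k : ℝ) + 1 ≤ K := by exact_mod_cast Finset.mem_range.1 hk
      rw [max_eq_left]
      rw [sub_nonpos, le_div_iff₀ (by positivity)]
      linarith
  | succ N hKN ih =>
    rw [Finset.sum_range_succ]
    have hKN' : (K : ℝ) ≤ N := by exact_mod_cast hKN
    have hN : (0 : ℝ) < N + 1 := by positivity
    rw [max_eq_right (a := (0 : ℝ)) (b := 1 - (K : ℝ) / (N + 1))
      (by rw [sub_nonneg, div_le_one hN]; linarith)]
    have hlog : Real.log (N + 1 + 1) - Real.log (N + 1) ≤ 1 / (N + 1) := by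
      rw [← Real.log_div (by positivity) hN.ne']
      refine (Real.log_le_sub_one_of_pos (by positivity)).trans (le_of_eq ?_)
      field_simp
      ring
    have := mul_le_mul_of_nonneg_left hlog (Nat.cast_nonneg (α := ℝ) K)
    rw [mul_one_div] at this
    push_cast
    linarith

/-- `K = ⌊N / e⌋` makes the logarithmic difference nearly `1`. Of the additive `3`, rounding costs
`1` and the error `2 / (N + 1)` in the logarithm, multiplied by `K`, costs at most `2`. -/
theorem floor_log_bound (N : ℕ) :
    ∃ K : ℕ, K ≤ N ∧
      (N : ℝ) - K * (Real.log (N + 1) - Real.log (K + 1)) ≤ (1 - 1 / Real.exp 1) * N + 3 := by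
  have he := Real.exp_pos 1
  have he1 : 1 < Real.exp 1 := Real.one_lt_exp_iff.2 one_pos
  have he3 : Real.exp 1 < 3 := Real.exp_one_lt_d9.trans (by norm_num)
  have hdiv : (N : ℝ) / Real.exp 1 ≤ N := div_le_self (Nat.cast_nonneg _) he1.le
  have hK0 : (⌊(N : ℝ) / Real.exp 1⌋₊ : ℝ) ≤ N / Real.exp 1 := Nat.floor_le (by positivity)
  have hK1 := Nat.lt_floor_add_one ((N : ℝ) / Real.exp 1)
  refine ⟨⌊(N : ℝ) / Real.exp 1⌋₊, by exact_mod_cast hK0.trans hdiv, ?_⟩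
  generalize ⌊(N : ℝ) / Real.exp 1⌋₊ = K at hK0 hK1
  have hN : (0 : ℝ) < N + 1 := by positivity
  have hlog : 1 - 2 / (N + 1) ≤ Real.log (N + 1) - Real.log (K + 1) := by
    have h1 : Real.log (K + 1) ≤ Real.log ((N + Real.exp 1) / Real.exp 1) := by
      refine Real.log_le_log (by positivity) ?_
      rw [add_div, div_self he.ne']
      linarith
    rw [Real.log_div (by positivity) he.ne', Real.log_exp] at h1
    have h2 : Real.log (N + Real.exp 1) - Real.log (N + 1) ≤ 2 / (N + 1) := by
      rw [← Real.log_div (by positivity) hN.ne']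
      refine (Real.log_le_sub_one_of_pos (by positivity)).trans ?_
      rw [div_sub_one hN.ne', div_le_div_iff_of_pos_right hN]
      linarith
    linarith
  have h3 := mul_le_mul_of_nonneg_left hlog (Nat.cast_nonneg (α := ℝ) K)
  have h4 : (K : ℝ) * (2 / (N + 1)) ≤ 2 := by
    rw [mul_div_assoc', div_le_iff₀ hN]
    linarith
  have h5 : (1 - 1 / Real.exp 1) * N = N - N / Real.exp 1 := by ring
  rw [h5]
  linarith

/-- On the randomly permuted upper triangular instance, a deterministic strategy matches on average
at most `(1 - 1/e) N + 3` vertices. -/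
theorem sum_card_run_triangular_le {n : ℕ} (s : Strategy (n + 1)) :
    ∑ σ : Equiv.Perm (Fin (n + 1)), ∑ _u ∈ run s ∅ (List.ofFn (triangularArrival σ)), (1 : ℝ) ≤
      (Fintype.card (Equiv.Perm (Fin (n + 1))) : ℝ) *
        ((1 - 1 / Real.exp 1) * (n + 1 : ℕ) + 3) := by
  set P : ℝ := (Fintype.card (Equiv.Perm (Fin (n + 1))) : ℝ) with hP
  have hP0 : 0 ≤ P := Nat.cast_nonneg _
  -- The last position is a neighbor of every arrival, so by symmetry it can stand for all positions
  -- `j ≥ t` at each time `t`.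
  set q : Fin (n + 1) → ℝ := fun t =>
    ∑ σ : Equiv.Perm (Fin (n + 1)),
      if σ (Fin.last n) ∈ triangularIncrement s σ t then (1 : ℝ) else 0 with hq
  have hcard : ∀ t, ∑ σ : Equiv.Perm (Fin (n + 1)), ((triangularIncrement s σ t).card : ℝ) =
      ((n + 1 : ℕ) - (t : ℕ) : ℝ) * q t := fun t => by
    simp only [card_triangularIncrement]
    rw [Finset.sum_comm, Finset.sum_congr rfl fun j hj =>
      sum_triangularIncrement_eq s (Finset.mem_Ici.1 hj) (Fin.le_last t), Finset.sum_const,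
      Fin.card_Ici, nsmul_eq_mul, Nat.cast_sub t.2.le]
  have hq1 : ∀ t : Fin (n + 1), ((n + 1 : ℕ) - (t : ℕ) : ℝ) * q t ≤ P := fun t => by
    rw [← hcard]
    calc _ ≤ ∑ _σ : Equiv.Perm (Fin (n + 1)), (1 : ℝ) := Finset.sum_le_sum fun σ _ => by
          exact_mod_cast card_increment_le_one _ _ _ _
      _ = P := by simp [hP]
  have hq2 : ∑ t, q t ≤ P := by
    rw [hq, Finset.sum_comm]
    -- For each `σ`, the vertex `σ (Fin.last n)` is matched at most once over all arrivals.
    calc _ ≤ ∑ _σ : Equiv.Perm (Fin (n + 1)), (1 : ℝ) := Finset.sum_le_sum fun σ _ => by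
          have := sum_run_ofFn s (fun u => if σ (Fin.last n) = u then (1 : ℝ) else 0)
            (triangularArrival σ)
          simp only [Finset.sum_ite_eq] at this
          unfold triangularIncrement
          rw [← this]
          split_ifs <;> norm_num
      _ = P := by simp [hP]
  have htot : ∑ σ : Equiv.Perm (Fin (n + 1)),
      ∑ _u ∈ run s ∅ (List.ofFn (triangularArrival σ)), (1 : ℝ) =
      ∑ t : Fin (n + 1), ((n + 1 : ℕ) - (t : ℕ) : ℝ) * q t := by
    simp only [← hcard]
    rw [Finset.sum_comm]
    refine Finset.sum_congr rfl fun σ _ => ?_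
    rw [sum_run_ofFn s (fun _ => (1 : ℝ))]
    simp [triangularIncrement]
  rw [htot]
  obtain ⟨K, hKN, hK⟩ := floor_log_bound (n + 1)
  -- Weak duality: `K` is the multiplier of `∑ t, q t ≤ P`, and `max 0 (1 - K / r)` that of `r * q t
  -- ≤ P`, where `r` is the number of remaining positions.
  have hterm : ∀ t : Fin (n + 1), ((n + 1 : ℕ) - (t : ℕ) : ℝ) * q t ≤
      K * q t + P * max 0 (1 - (K : ℝ) / ((n + 1 : ℕ) - (t : ℕ))) := fun t => by
    have ht : (0 : ℝ) < (n + 1 : ℕ) - (t : ℕ) := sub_pos.2 (by exact_mod_cast t.2)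
    set r : ℝ := (n + 1 : ℕ) - (t : ℕ)
    have hq0 : 0 ≤ q t := Finset.sum_nonneg fun σ _ => by split_ifs <;> norm_num
    calc r * q t = K * q t + r * q t * (1 - K / r) := by field_simp; ring
      _ ≤ K * q t + r * q t * max 0 (1 - K / r) := by gcongr; exact le_max_right _ _
      _ ≤ K * q t + P * max 0 (1 - K / r) := by gcongr; exact hq1 t
  have hsum : ∑ t : Fin (n + 1), max 0 (1 - (K : ℝ) / ((n + 1 : ℕ) - (t : ℕ))) =
      ∑ k ∈ Finset.range (n + 1), max 0 (1 - (K : ℝ) / (k + 1)) := by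
    rw [Fin.sum_univ_eq_sum_range
      (fun t : ℕ => max 0 (1 - (K : ℝ) / ((n + 1 : ℕ) - (t : ℕ)))) (n + 1),
      ← Finset.sum_range_reflect]
    refine Finset.sum_congr rfl fun k hk => ?_
    have hk' : k ≤ n := Nat.lt_succ_iff.1 (Finset.mem_range.1 hk)
    rw [show n + 1 - 1 - k = n - k by omega, Nat.cast_sub hk']
    push_cast
    congr 3
    ring
  calc _ ≤ ∑ t : Fin (n + 1),
        (K * q t + P * max 0 (1 - (K : ℝ) / ((n + 1 : ℕ) - (t : ℕ)))) :=
        Finset.sum_le_sum fun t _ => hterm t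
    _ = K * ∑ t, q t + P * ∑ k ∈ Finset.range (n + 1), max 0 (1 - (K : ℝ) / (k + 1)) := by
        rw [Finset.sum_add_distrib, ← Finset.mul_sum, ← Finset.mul_sum, hsum]
    _ ≤ K * P + P * ∑ k ∈ Finset.range (n + 1), max 0 (1 - (K : ℝ) / (k + 1)) := by gcongr
    _ = P * (K + ∑ k ∈ Finset.range (n + 1), max 0 (1 - (K : ℝ) / (k + 1))) := by ring
    _ ≤ _ := mul_le_mul_of_nonneg_left ((add_sum_max_le hKN).trans hK) hP0

/-! ### From deterministic strategies to all randomized algorithms -/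

theorem exists_expectedGain_triangularInput_le (A : RandomizedAlgorithm.{u}) (n : ℕ) :
    ∃ σ : Equiv.Perm (Fin (n + 1)),
      expectedGain A (triangularInput σ) ≤ (1 - 1 / Real.exp 1) * (n + 1 : ℕ) + 3 := by
  set R := A (n + 1) (fun _ => 1)
  let _ := R.measurableSpace
  have := R.isProbabilityMeasure
  have hgain : ∀ σ : Equiv.Perm (Fin (n + 1)), expectedGain A (triangularInput σ) =
      ∫ ω, (∑ _u ∈ run (R.strategy ω) ∅ (List.ofFn (triangularArrival σ)), (1 : ℝ)) ∂(R.μ) :=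
    fun σ => by
      rw [← triangularInput_arrivals]
      rfl
  have hint := fun σ : Equiv.Perm (Fin (n + 1)) =>
    integrable_sum_run (μ := R.μ) ∅ R.measurable_strategy (f := fun _ => (1 : ℝ))
      (fun _ => zero_le_one) (List.ofFn (triangularArrival σ))
  -- Yao's principle: the bound on the sum over `σ` holds for each `ω`, hence after integration, so
  -- some fixed `σ` is at most the average.
  obtain ⟨σ, -, h⟩ := Finset.exists_le_of_sum_le (s := Finset.univ)
    (f := fun σ => expectedGain A (triangularInput σ))
    (g := fun _ : Equiv.Perm (Fin (n + 1)) => (1 - 1 / Real.exp 1) * (n + 1 : ℕ) + 3)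
    Finset.univ_nonempty (by
      simp only [hgain]
      rw [← integral_finsetSum _ fun σ _ => hint σ, Finset.sum_const, nsmul_eq_mul,
        Finset.card_univ]
      refine (integral_mono (integrable_finsetSum _ fun σ _ => hint σ) (integrable_const _)
        fun ω => sum_card_run_triangular_le (R.strategy ω)).trans (le_of_eq ?_)
      simp)
  exact ⟨σ, h⟩

theorem competitiveRatio_le (A : RandomizedAlgorithm.{u}) :
    competitiveRatio A ≤ ((1 - 1 / Real.exp 1 : ℝ) : EReal) := by
  have hlim : Filter.Tendsto (fun n : ℕ => 1 - 1 / Real.exp 1 + 3 * (1 / ((n : ℝ) + 1)))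
      Filter.atTop (nhds (1 - 1 / Real.exp 1)) := by
    simpa using (tendsto_one_div_add_atTop_nhds_zero_nat (𝕜 := ℝ)).const_mul 3 |>.const_add
      (1 - 1 / Real.exp 1)
  refine ge_of_tendsto' ((continuous_coe_real_ereal.tendsto _).comp hlim) fun n => ?_
  obtain ⟨σ, hσ⟩ := exists_expectedGain_triangularInput_le A n
  have hopt := le_opt_triangularInput σ
  have hn : (0 : ℝ) < (n + 1 : ℕ) := by positivity
  refine (iInf₂_le (triangularInput σ) (hn.trans_le hopt)).trans (EReal.coe_le_coe_iff.2 ?_)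
  calc expectedGain A (triangularInput σ) / (triangularInput σ).opt
      ≤ expectedGain A (triangularInput σ) / (n + 1 : ℕ) :=
        div_le_div_of_nonneg_left (expectedGain_nonneg A _) hn hopt
    _ ≤ ((1 - 1 / Real.exp 1) * (n + 1 : ℕ) + 3) / (n + 1 : ℕ) := by gcongr
    _ = 1 - 1 / Real.exp 1 + 3 * (1 / ((n : ℝ) + 1)) := by
        push_cast at hn ⊢
        rw [add_div, mul_div_cancel_right₀ _ hn.ne', mul_one_div]

end OnlineMatching

end

/-- The competitive ratio of Perturbed-Greedy is `1 - 1/e`, and no randomized online algorithm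
has a better one. -/
theorem theorem1 :
    OnlineMatching.competitiveRatio OnlineMatching.perturbedGreedy =
        ((1 - 1 / Real.exp 1 : ℝ) : EReal) ∧
      ∀ A : OnlineMatching.RandomizedAlgorithm.{u},
        OnlineMatching.competitiveRatio A ≤ ((1 - 1 / Real.exp 1 : ℝ) : EReal) :=
  ⟨le_antisymm (OnlineMatching.competitiveRatio_le _)
    OnlineMatching.le_competitiveRatio_perturbedGreedy, OnlineMatching.competitiveRatio_le⟩
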